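/- Let $X$ and $Y$ be smooth projective irreducible curves over $\mathbb{C}$ and let $\phi\colon X\to Y$ be a morphism of degree $4$. Let $\pi\colon E\to Y$ be a smooth elliptic surface, that is, a smooth irreducible complex surface $E$ with a proper morphism $\pi$ to $Y$ and a section $\sigma_0\colon Y\to E$ (the zero section), such that the generic fibre of $\pi$, with the rational point given by $\sigma_0$, is an elliptic curve over the function field $K(Y)$. The sections of $\pi$ correspond to the $K(Y)$-rational points of the generic fibre, and so they form an abelian group with neutral element $\sigma_0$. Let $2_E\colon E\dashrightarrow E$ be the rational map over $Y$ which is multiplication by $2$ on the generic fibre. Suppose that there are a section $\sigma\colon Y\to E$ of $\pi$ and a morphism $\tau\colon X\to E$, injective on a nonempty open subset of $X$, such that \[ 2_E\circ\tau=\sigma\circ\phi \] (as rational maps; in particular $2_E$ is defined at the image of the generic point of $X$). Then: 1. $\sigma$ has no half in the group of sections of $E$: there is no section $\sigma'$ with $2\sigma'=\sigma$; 2. $\sigma\neq\sigma_0$; 3. consequently $E$ has a section distinct from the zero section. -/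

import Mathlib

open CategoryTheory CategoryTheory.Limits AlgebraicGeometry

namespace EllipticDuplication

/-! ### Weierstrass curves and elliptic curves as schemes -/

/-- The affine plane curve `Spec K[X, Y] / (Y² + a₁XY + a₃Y - X³ - a₂X² - a₄X - a₆)`. -/
noncomputable def affineCurve {K : Type} [Field K] (W : WeierstrassCurve K) : Scheme.{0} :=
  Spec (.of W.toAffine.CoordinateRing)

/-- The structure morphism of the affine plane curve. -/
noncomputable def affineCurveHom {K : Type} [Field K] (W : WeierstrassCurve K) :
    affineCurve W ⟶ Spec (.of K) :=
  Spec.map (CommRingCat.ofHom (algebraMap K W.toAffine.CoordinateRing))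

/-- `chart` identifies the affine Weierstrass curve of `W` with the complement of the point `o` in
the `K`-scheme `p : C ⟶ Spec K`. -/
structure IsWeierstrassChart {K : Type} [Field K] {C : Scheme.{0}} (p : C ⟶ Spec (.of K))
    (o : Spec (.of K) ⟶ C) (W : WeierstrassCurve K) (chart : affineCurve W ⟶ C) : Prop where
  isOpenImmersion : IsOpenImmersion chart
  chart_comp : chart ≫ p = affineCurveHom W
  range_chart : Set.range chart = (Set.range o)ᶜ

/-- The `K`-scheme `p : C ⟶ Spec K` with the rational point `o` is an elliptic curve: it is a smooth
proper curve which is the completion, by the single point `o` at infinity, of a smooth affine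
Weierstrass cubic. -/
structure IsEllipticCurve {K : Type} [Field K] {C : Scheme.{0}} (p : C ⟶ Spec (.of K))
    (o : Spec (.of K) ⟶ C) : Prop where
  isProper : IsProper p
  smooth : SmoothOfRelativeDimension 1 p
  o_comp : o ≫ p = 𝟙 _
  exists_chart : ∃ (W : WeierstrassCurve K) (_ : W.IsElliptic) (chart : affineCurve W ⟶ C),
    IsWeierstrassChart p o W chart

section
variable {K : Type} [Field K] (W : WeierstrassCurve K) {L : Type} [Field L] (f : K →+* L)

theorem eval₂_polynomial_eq (x y : L) :
    W.toAffine.polynomial.eval₂ (Polynomial.eval₂RingHom f x) y =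
      (W.map f).toAffine.polynomial.evalEval x y := by
  have h := WeierstrassCurve.Affine.map_polynomial (W := W.toAffine) f
  change (W.map f).toAffine.polynomial = _ at h
  rw [h, Polynomial.eval₂_eval₂RingHom_apply]

/-- Evaluation of the coordinate ring at a solution `(x, y)` in an extension `f : K →+* L`. -/
noncomputable def evalHom {x y : L}
    (h : (W.map f).toAffine.Equation x y) : W.toAffine.CoordinateRing →+* L :=
  AdjoinRoot.lift (Polynomial.eval₂RingHom f x) y ((eval₂_polynomial_eq W f x y).trans h)

/-- The `L`-valued point of the affine curve with coordinates `(x, y)`. -/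
noncomputable def evalPoint {x y : L} (h : (W.map f).toAffine.Equation x y) :
    Spec (.of L) ⟶ affineCurve W := Spec.map (CommRingCat.ofHom (evalHom W f h))

theorem evalPoint_comp {x y : L} (h : (W.map f).toAffine.Equation x y) :
    evalPoint W f h ≫ affineCurveHom W = Spec.map (CommRingCat.ofHom f) := by
  rw [evalPoint, affineCurveHom]
  refine (Spec.map_comp _ _).symm.trans ?_
  congr 1
  ext a
  simp [evalHom, IsScalarTower.algebraMap_apply K (Polynomial K) W.toAffine.CoordinateRing]

theorem exists_evalPoint (q : Spec (.of L) ⟶ affineCurve W)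
    (hq : q ≫ affineCurveHom W = Spec.map (CommRingCat.ofHom f)) :
    ∃ (x y : L) (h : (W.map f).toAffine.Equation x y), evalPoint W f h = q := by
  obtain ⟨g, rfl⟩ : ∃ g : CommRingCat.of W.toAffine.CoordinateRing ⟶ CommRingCat.of L, Spec.map g = q := Spec.map_surjective q
  have hg : CommRingCat.ofHom (algebraMap K W.toAffine.CoordinateRing) ≫ g = CommRingCat.ofHom f := by
    apply Spec.map_injective
    rw [← hq]
    exact Spec.map_comp _ _
  replace hg : g.hom.comp (algebraMap K W.toAffine.CoordinateRing) = f :=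
    congrArg CommRingCat.Hom.hom hg
  have key : (Polynomial.eval₂RingHom f (g.hom (AdjoinRoot.of _ Polynomial.X))) =
      g.hom.comp (AdjoinRoot.of W.toAffine.polynomial) := by
    ext a
    · simp [← hg, IsScalarTower.algebraMap_apply K (Polynomial K) W.toAffine.CoordinateRing]
    · simp
  refine ⟨g.hom (AdjoinRoot.of _ Polynomial.X), g.hom (AdjoinRoot.root _), ?_, ?_⟩
  · refine (eval₂_polynomial_eq W f _ _).symm.trans ?_
    rw [key, ← Polynomial.hom_eval₂, AdjoinRoot.eval₂_root, map_zero]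
  · refine congrArg Spec.map ?_
    ext1
    apply AdjoinRoot.ringHom_ext
    · refine Eq.trans ?_ key
      ext a
      · simp [evalHom]
      · simp [evalHom]
    · simp [evalHom]

theorem evalPoint_inj {x y x' y' : L} (h : (W.map f).toAffine.Equation x y)
    (h' : (W.map f).toAffine.Equation x' y') (e : evalPoint W f h = evalPoint W f h') :
    x = x' ∧ y = y' := by
  have e' := congrArg CommRingCat.Hom.hom (Spec.map_injective e)
  constructor
  · have := DFunLike.congr_fun e' (AdjoinRoot.of _ Polynomial.X)
    simpa [evalHom] using this
  · have := DFunLike.congr_fun e' (AdjoinRoot.root _)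
    simpa [evalHom] using this

end

section

variable {K : Type} [Field K] {C : Scheme.{0}} {p : C ⟶ Spec (.of K)} {o : Spec (.of K) ⟶ C}
  {W : WeierstrassCurve K} {L : Type} [Field L] (f : K →+* L)

/-- The `L`-valued point of `C` given by a point of the Weierstrass curve over `L`: the point at
infinity goes to `o`, and `(x, y)` to the point of the chart with these coordinates. -/
noncomputable def pointHom (o : Spec (.of K) ⟶ C) (chart : affineCurve W ⟶ C) :
    (W.map f).toAffine.Point → (Spec (.of L) ⟶ C)
  | .zero => Spec.map (CommRingCat.ofHom f) ≫ o
  | .some _ _ h => evalPoint W f h.1 ≫ chart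

theorem pointHom_comp {chart : affineCurve W ⟶ C} (ho : o ≫ p = 𝟙 _)
    (hc : IsWeierstrassChart p o W chart) (P : (W.map f).toAffine.Point) :
    pointHom f o chart P ≫ p = Spec.map (CommRingCat.ofHom f) := by
  match P with
  | .zero => simp [pointHom, ho]
  | .some _ _ h => simp [pointHom, hc.chart_comp, evalPoint_comp]

theorem pointHom_bijective [IsSeparated p] [W.IsElliptic] {chart : affineCurve W ⟶ C}
    (ho : o ≫ p = 𝟙 _) (hc : IsWeierstrassChart p o W chart) :
    Function.Bijective (fun P : (W.map f).toAffine.Point ↦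
      (⟨pointHom f o chart P, pointHom_comp f ho hc P⟩ :
        {q : Spec (.of L) ⟶ C // q ≫ p = Spec.map (CommRingCat.ofHom f)})) := by
  have := hc.isOpenImmersion
  have hne : ∀ {x y : L} (h : (W.map f).toAffine.Equation x y),
      Spec.map (CommRingCat.ofHom f) ≫ o ≠ evalPoint W f h ≫ chart := by
    intro x y h e
    have h1 : (evalPoint W f h ≫ chart) (IsLocalRing.closedPoint L) ∈ Set.range chart :=
      ⟨_, (Scheme.Hom.comp_apply _ _ _).symm⟩
    rw [← e, hc.range_chart] at h1
    exact h1 ⟨_, (Scheme.Hom.comp_apply _ _ _).symm⟩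
  constructor
  · intro P Q e
    have e := congrArg Subtype.val e
    dsimp only at e
    match P, Q with
    | .zero, .zero => rfl
    | .zero, .some _ _ h => exact (hne _ e).elim
    | .some _ _ h, .zero => exact (hne _ e.symm).elim
    | .some _ _ h, .some _ _ h' =>
      obtain ⟨rfl, rfl⟩ := evalPoint_inj W f h.1 h'.1 ((cancel_mono chart).mp e)
      rfl
  · rintro ⟨q, hq⟩
    by_cases hmem : Set.range q ⊆ Set.range chart
    · have hl : IsOpenImmersion.lift chart q hmem ≫ affineCurveHom W =
          Spec.map (CommRingCat.ofHom f) := by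
        rw [← hc.chart_comp, IsOpenImmersion.lift_fac_assoc, hq]
      obtain ⟨x, y, h, e⟩ := exists_evalPoint W f _ hl
      refine ⟨.some x y (WeierstrassCurve.Affine.equation_iff_nonsingular.mp h), Subtype.ext ?_⟩
      simp [pointHom, e]
    · refine ⟨.zero, Subtype.ext ?_⟩
      change Spec.map (CommRingCat.ofHom f) ≫ o = q
      have : IsClosedImmersion (o ≫ p) := by rw [ho]; infer_instance
      have : IsClosedImmersion o := .of_comp o p
      obtain ⟨_, ⟨z, rfl⟩, hz⟩ := Set.not_subset.mp hmem
      rw [hc.range_chart, Set.notMem_compl_iff] at hz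
      obtain ⟨w, hw⟩ := hz
      obtain ⟨v, hv, -⟩ := Scheme.Pullback.exists_preimage_pullback z w hw.symm
      have : Surjective (pullback.fst q o) := ⟨fun z' ↦ ⟨v, hv.trans (Subsingleton.elim _ _)⟩⟩
      have := isIso_of_isClosedImmersion_of_surjective (pullback.fst q o)
      have e : q = (inv (pullback.fst q o) ≫ pullback.snd q o) ≫ o := by
        rw [Category.assoc, ← pullback.condition, IsIso.inv_hom_id_assoc]
      have e' : inv (pullback.fst q o) ≫ pullback.snd q o = Spec.map (CommRingCat.ofHom f) := by
        rw [← hq]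
        conv_rhs => rw [e, Category.assoc, ho, Category.comp_id]
      rw [← e']
      exact e.symm
end

/-! ### Function fields and curves -/

/-- The function field of an integral scheme. -/
def FunctionField (Y : Scheme.{0}) [IsIntegral Y] : Type := Y.functionField

noncomputable instance (Y : Scheme.{0}) [IsIntegral Y] : Field (FunctionField Y) :=
  inferInstanceAs (Field Y.functionField)

/-- The inclusion of the generic point. -/
noncomputable def genericMap (Y : Scheme.{0}) [IsIntegral Y] :
    Spec (.of (FunctionField Y)) ⟶ Y :=
  Y.fromSpecStalk (genericPoint Y)

instance (Y : Scheme.{0}) [IsIntegral Y] : IsDominant (genericMap Y) := by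
  refine ⟨?_⟩
  have h : genericPoint Y ∈ Set.range (genericMap Y) :=
    ⟨IsLocalRing.closedPoint (Y.presheaf.stalk (genericPoint Y)), Y.fromSpecStalk_closedPoint⟩
  refine Dense.mono (Set.singleton_subset_iff.mpr h) ?_
  exact dense_iff_closure_eq.mpr (genericPoint_spec Y)

theorem map_genericPoint {X Y : Scheme.{0}} [IsIntegral X] [IsIntegral Y] (g : X ⟶ Y)
    [IsDominant g] : g (genericPoint X) = genericPoint Y := by
  apply ((genericPoint_spec Y).eq _).symm
  have h := (genericPoint_spec X).image g.continuous
  rwa [Set.image_univ, g.denseRange.closure_range] at h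

/-- The pullback of rational functions along a dominant morphism. -/
noncomputable def functionFieldMap {X Y : Scheme.{0}} [IsIntegral X] [IsIntegral Y] (g : X ⟶ Y)
    [IsDominant g] : FunctionField Y →+* FunctionField X :=
  (Y.presheaf.stalkSpecializes (specializes_of_eq (map_genericPoint g)) ≫
    g.stalkMap (genericPoint X)).hom

theorem genericMap_comp {X Y : Scheme.{0}} [IsIntegral X] [IsIntegral Y] (g : X ⟶ Y)
    [IsDominant g] :
    genericMap X ≫ g = Spec.map (CommRingCat.ofHom (functionFieldMap g)) ≫ genericMap Y := by
  change _ = Spec.map (Y.presheaf.stalkSpecializes (specializes_of_eq (map_genericPoint g)) ≫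
    g.stalkMap (genericPoint X)) ≫ Y.fromSpecStalk (genericPoint Y)
  rw [Spec.map_comp, Category.assoc, Scheme.SpecMap_stalkSpecializes_fromSpecStalk,
    Scheme.SpecMap_stalkMap_fromSpecStalk]
  rfl

/-- The degree of a dominant morphism: the degree of the extension of function fields. -/
noncomputable def degree {X Y : Scheme.{0}} [IsIntegral X] [IsIntegral Y] (g : X ⟶ Y)
    [IsDominant g] : ℕ :=
  @Module.finrank (FunctionField Y) (FunctionField X) _ _ (functionFieldMap g).toAlgebra.toModule

/-- `g` is injective on some nonempty open subset. -/
def GenericallyInjective {X Y : Scheme.{0}} (g : X ⟶ Y) : Prop :=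
  ∃ U : X.Opens, (U : Set X).Nonempty ∧ Set.InjOn g U

/-- Smooth projective (equivalently, smooth proper) irreducible curves over `ℂ`. -/
class IsSmoothProjectiveCurve (Y : Scheme.{0}) [Y.Over (Spec (.of ℂ))] : Prop where
  isIntegral : IsIntegral Y
  isProper : IsProper (Y ↘ Spec (.of ℂ))
  smooth : SmoothOfRelativeDimension 1 (Y ↘ Spec (.of ℂ))

attribute [instance] IsSmoothProjectiveCurve.isIntegral IsSmoothProjectiveCurve.isProper
  IsSmoothProjectiveCurve.smooth

instance (Y : Scheme.{0}) [Y.Over (Spec (.of ℂ))] [IsSmoothProjectiveCurve Y] :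
    Y.IsSeparated := ⟨by
  rw [← terminal.comp_from (Y ↘ Spec (.of ℂ))]
  infer_instance⟩

theorem isPrincipal_maximalIdeal_of_etale {P A R : Type*} [CommRing P] [IsDomain P]
    [IsPrincipalIdealRing P] [CommRing A] [Algebra P A] [Algebra.Etale P A] (p : Ideal A)
    [p.IsPrime] [CommRing R] [IsLocalRing R] [Algebra A R] [IsLocalization.AtPrime R p] :
    (IsLocalRing.maximalIdeal R).IsPrincipal := by
  have h : (IsLocalRing.maximalIdeal (Localization.AtPrime p)).IsPrincipal := by
    let q := p.under P
    let : Algebra (Localization.AtPrime q) (Localization.AtPrime p) :=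
      Localization.AtPrime.algebraOfLiesOver q p
    have h1 := (Algebra.isUnramifiedAt_iff_map_eq P q p).mp inferInstance
    rw [← h1.2]
    infer_instance
  let e : Localization.AtPrime p ≃+* R := 
    (IsLocalization.algEquiv p.primeCompl (Localization.AtPrime p) R).toRingEquiv
  rw [← IsLocalRing.map_ringEquiv_maximalIdeal e]
  exact Submodule.IsPrincipal.map_ringHom e.toRingHom h

theorem valuationRing_stalk (Y : Scheme.{0}) [IsIntegral Y] (s : Y ⟶ Spec (.of ℂ))
    [SmoothOfRelativeDimension 1 s] (y : Y) : ValuationRing (Y.presheaf.stalk y) := by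
  have : Smooth s := SmoothOfRelativeDimension.smooth 1 s
  have : IsLocallyNoetherian Y := LocallyOfFiniteType.isLocallyNoetherian s
  obtain ⟨U, hU, V, hV, hyV, e, h⟩ :=
    SmoothOfRelativeDimension.exists_isStandardSmoothOfRelativeDimension (n := 1) (f := s) y
  obtain ⟨g, -, hg⟩ := h.exists_etale_mvPolynomial
  let _ := g.toAlgebra
  have : Algebra.Etale (MvPolynomial (Fin 1) Γ(Spec (.of ℂ), U)) Γ(Y, V) := hg
  have : IsField Γ(Spec (.of ℂ), U) := by
    have hU' : U = ⊤ := by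
      ext z
      have hz : z = s y := Subsingleton.elim _ _
      rw [hz]
      exact iff_of_true (e hyV) trivial
    rw [hU']
    exact (Scheme.ΓSpecIso (.of ℂ)).commRingCatIsoToRingEquiv.toMulEquiv.isField
      (Field.toIsField ℂ)
  let := this.toField
  have : IsPrincipalIdealRing (MvPolynomial (Fin 1) Γ(Spec (.of ℂ), U)) :=
    .of_surjective (MvPolynomial.uniqueAlgEquiv Γ(Spec (.of ℂ), U) (Fin 1)).symm.toRingHom
      (MvPolynomial.uniqueAlgEquiv Γ(Spec (.of ℂ), U) (Fin 1)).symm.surjective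
  let _ : Algebra Γ(Y, V) (Y.presheaf.stalk y) :=
    TopCat.Presheaf.algebra_section_stalk Y.presheaf (⟨y, hyV⟩ : V)
  have : IsLocalization.AtPrime (Y.presheaf.stalk y) (hV.primeIdealOf ⟨y, hyV⟩).asIdeal :=
    hV.isLocalization_stalk ⟨y, hyV⟩
  have : (IsLocalRing.maximalIdeal (Y.presheaf.stalk y)).IsPrincipal := 
    isPrincipal_maximalIdeal_of_etale (P := MvPolynomial (Fin 1) Γ(Spec (.of ℂ), U))
     (A := Γ(Y, V)) (hV.primeIdealOf ⟨y, hyV⟩).asIdeal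
  exact ((tfae_of_isNoetherianRing_of_isLocalRing_of_isDomain (Y.presheaf.stalk y)).out 4 1).mp this

theorem exists_lift_of_isProper {X Y : Scheme.{0}} (f : X ⟶ Y) [IsProper f] (R K : CommRingCat.{0})
    [IsDomain R] [ValuationRing R] (hK : IsField K) (φ : R ⟶ K)
    (hφ : @IsFractionRing R _ K _ φ.hom.toAlgebra) (i₁ : Spec K ⟶ X) (i₂ : Spec R ⟶ Y)
    (h : i₁ ≫ f = Spec.map φ ≫ i₂) :
    ∃ l : Spec R ⟶ X, Spec.map φ ≫ l = i₁ ∧ l ≫ f = i₂ := by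
  have hv := (IsProper.eq_valuativeCriterion.le _ _ f ‹_›).1.1.1.existence
  let S : ValuativeCommSq f :=
    { R := R
      K := K
      field := hK.toField
      algebra := φ.hom.toAlgebra
      isFractionRing := hφ
      i₁ := i₁
      i₂ := i₂
      commSq := ⟨h⟩ }
  obtain ⟨⟨l, h₁, h₂⟩⟩ := (hv S).exists_lift
  exact ⟨l, h₁, h₂⟩

theorem exists_section {Y E : Scheme.{0}} [IsIntegral Y] [Y.IsSeparated]
    (hY : ∀ y : Y, ValuationRing (Y.presheaf.stalk y)) (π : E ⟶ Y) [IsProper π]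
    (g : Spec (.of (FunctionField Y)) ⟶ E) (hg : g ≫ π = genericMap Y) :
    ∃ s : Y ⟶ E, s ≫ π = 𝟙 Y ∧ genericMap Y ≫ s = g := by
  have : E.IsSeparated := ⟨by
    rw [← terminal.comp_from π]
    infer_instance⟩
  let r : Y ⤏ E := Scheme.RationalMap.ofFunctionField (𝟙 Y) π g (by
    rw [Category.comp_id]; exact hg)
  have hr : r.fromFunctionField = g := Scheme.RationalMap.fromFunctionField_ofFunctionField ..
  have hdom : r.domain = ⊤ := by
    rw [eq_top_iff]
    intro y _
    have hsp : Spec.map (Y.presheaf.stalkSpecializes (genericPoint_specializes y)) ≫ 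
        Y.fromSpecStalk y = Y.fromSpecStalk (genericPoint Y) :=
      Scheme.SpecMap_stalkSpecializes_fromSpecStalk _
    have := hY y
    obtain ⟨l, hl₁, hl₂⟩ : ∃ l : Spec (Y.presheaf.stalk y) ⟶ E,
        Spec.map (Y.presheaf.stalkSpecializes (genericPoint_specializes y)) ≫ l = g ∧
          l ≫ π = Y.fromSpecStalk y :=
      exists_lift_of_isProper π (Y.presheaf.stalk y) Y.functionField (Field.toIsField _) _
        (inferInstanceAs (IsFractionRing (Y.presheaf.stalk y) Y.functionField)) g
        (Y.fromSpecStalk y) (hg.trans hsp.symm)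
    let t : Y.PartialMap E := .ofFromSpecStalk (𝟙 Y) π l (by rw [Category.comp_id]; exact hl₂)
    refine Scheme.RationalMap.mem_domain.mpr ⟨t, Scheme.PartialMap.mem_domain_ofFromSpecStalk .., ?_⟩
    apply Scheme.RationalMap.eq_of_fromFunctionField_eq
    rw [hr, ← hl₁]
    change t.domain.fromSpecStalkOfMem (genericPoint Y) _ ≫ t.hom = Spec.map
      (Y.presheaf.stalkSpecializes (genericPoint_specializes y)) ≫ l
    have ht : t.domain.fromSpecStalkOfMem y (Scheme.PartialMap.mem_domain_ofFromSpecStalk ..) ≫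
        t.hom = l := Scheme.PartialMap.fromSpecStalkOfMem_ofFromSpecStalk ..
    rw [← ht, ← Category.assoc]
    congr 1
    rw [← cancel_mono t.domain.ι, Category.assoc, Scheme.Opens.fromSpecStalkOfMem_ι,
      Scheme.Opens.fromSpecStalkOfMem_ι, hsp]
  have hdom' : r.toPartialMap.domain = ⊤ := hdom
  let s : Y ⟶ E := Y.topIso.inv ≫ (Y.isoOfEq hdom').inv ≫ r.toPartialMap.hom
  have hs : genericMap Y ≫ s = g := by
    have h1 : r.toPartialMap.fromFunctionField = g := by
      rw [← Scheme.RationalMap.fromFunctionField_toRationalMap,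
        Scheme.RationalMap.toRationalMap_toPartialMap, hr]
    rw [← h1]
    change Y.fromSpecStalk (genericPoint Y) ≫ Y.topIso.inv ≫ (Y.isoOfEq hdom').inv ≫
      r.toPartialMap.hom = r.toPartialMap.domain.fromSpecStalkOfMem _ _ ≫ r.toPartialMap.hom
    simp only [← Category.assoc]
    congr 1
    rw [← cancel_mono r.toPartialMap.domain.ι]
    simp
  refine ⟨s, ?_, hs⟩
  refine ext_of_isDominant_of_isSeparated (terminal.from Y) (Subsingleton.elim _ _) (genericMap Y) ?_
  rw [← Category.assoc, hs, hg, Category.comp_id]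

/-! ### Elliptic surfaces -/

/-- A smooth elliptic surface over the curve `Y`: a smooth irreducible surface with a proper
fibration `π` over `Y` and a zero section, whose generic fibre, with the point given by the zero
section, is an elliptic curve. The fibration is not required to be relatively minimal. -/
structure EllipticSurface (Y : Scheme.{0}) [Y.Over (Spec (.of ℂ))] [IsIntegral Y] where
  carrier : Scheme.{0}
  π : carrier ⟶ Y
  zero : Y ⟶ carrier
  isIntegral : IsIntegral carrier
  isProper : IsProper π
  smooth : SmoothOfRelativeDimension 2 (π ≫ Y ↘ Spec (.of ℂ))
  zero_π : zero ≫ π = 𝟙 Y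
  isEllipticCurve_generic : IsEllipticCurve (pullback.snd π (genericMap Y))
    (pullback.lift (genericMap Y ≫ zero) (𝟙 _) (by simp [zero_π]))

namespace EllipticSurface

attribute [instance] EllipticSurface.isIntegral EllipticSurface.isProper

section

variable {Y : Scheme.{0}} [Y.Over (Spec (.of ℂ))] [IsIntegral Y] (E : EllipticSurface Y)

instance : IsDominant E.π := by
  have : Surjective E.π := ⟨fun y ↦ ⟨E.zero y, by
    rw [← Scheme.Hom.comp_apply, E.zero_π]; rfl⟩⟩
  infer_instance

/-- A Weierstrass equation of the generic fibre. -/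
noncomputable def weierstrass : WeierstrassCurve (FunctionField Y) :=
  E.isEllipticCurve_generic.exists_chart.choose

instance : E.weierstrass.IsElliptic :=
  E.isEllipticCurve_generic.exists_chart.choose_spec.choose

/-- The identification of the affine Weierstrass curve with the generic fibre without the zero
point. -/
noncomputable def chart : affineCurve E.weierstrass ⟶ pullback E.π (genericMap Y) :=
  E.isEllipticCurve_generic.exists_chart.choose_spec.choose_spec.choose

theorem isWeierstrassChart : IsWeierstrassChart (pullback.snd E.π (genericMap Y))
    (pullback.lift (genericMap Y ≫ E.zero) (𝟙 _) (by simp [E.zero_π])) E.weierstrass E.chart :=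
  E.isEllipticCurve_generic.exists_chart.choose_spec.choose_spec.choose_spec

/-- The `L`-valued points of the generic fibre, for a field extension `f` of the function field of
`Y`. -/
def Points {L : Type} [Field L] (f : FunctionField Y →+* L) : Type :=
  {q : Spec (.of L) ⟶ E.carrier // q ≫ E.π = Spec.map (CommRingCat.ofHom f) ≫ genericMap Y}

/-- The bijection between the points over `L` of the Weierstrass curve, which form a group under
the chord-and-tangent law, and the `L`-valued points of the generic fibre. -/
noncomputable def pointEquiv {L : Type} [Field L] (f : FunctionField Y →+* L) :
    (E.weierstrass.map f).toAffine.Point ≃ E.Points f :=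
  (Equiv.ofBijective _ (pointHom_bijective f E.isEllipticCurve_generic.o_comp
    E.isWeierstrassChart)).trans
    { toFun q := ⟨q.1 ≫ pullback.fst _ _, by
        rw [Category.assoc, pullback.condition, ← Category.assoc, q.2]⟩
      invFun q := ⟨pullback.lift q.1 (Spec.map (CommRingCat.ofHom f)) q.2, pullback.lift_snd _ _ _⟩
      left_inv q := Subtype.ext (by
        apply pullback.hom_ext
        · exact pullback.lift_fst _ _ _
        · exact (pullback.lift_snd _ _ _).trans q.2.symm)
      right_inv q := Subtype.ext (pullback.lift_fst _ _ _) }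

open scoped Classical in
/-- The group structure on the `L`-valued points of the generic fibre: the chord-and-tangent law. (It
is the group law of the elliptic curve, so it does not depend on the Weierstrass equation.) -/
noncomputable instance {L : Type} [Field L] (f : FunctionField Y →+* L) :
    AddCommGroup (E.Points f) :=
  (E.pointEquiv f).symm.addCommGroup

/-- The sections of `π`. -/
def Section : Type := {s : Y ⟶ E.carrier // s ≫ E.π = 𝟙 Y}

/-- The zero section. -/
def zeroSection : E.Section := ⟨E.zero, E.zero_π⟩

/-- The generic point of `E`, as a point of the generic fibre over the function field of `E`. -/
noncomputable def tautologicalPoint : E.Points (functionFieldMap E.π) :=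
  ⟨genericMap E.carrier, genericMap_comp E.π⟩

/-- The duplication `2_E`, as a rational map over `Y` from `E` to itself: it sends the generic point
of `E` to its double in the group of points of the generic fibre. -/
noncomputable def duplication : E.carrier ⤏ E.carrier :=
  Scheme.RationalMap.ofFunctionField E.π E.π (2 • E.tautologicalPoint).1
    ((2 • E.tautologicalPoint).2.trans (genericMap_comp E.π).symm)

/-- Commutativity of the square `2_E ∘ τ = σ ∘ φ` of rational maps: the rational map `2_E` is
defined at the image under `τ` of the generic point of `X`, and the two composites agree on a
nonempty open subset. -/
def DuplicationSquare {X : Scheme.{0}} (φ : X ⟶ Y) (τ : X ⟶ E.carrier) (σ : E.Section) : Prop :=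
  ∃ g : E.carrier.PartialMap E.carrier, g.toRationalMap = E.duplication ∧
    ∃ (U : X.Opens) (hU : U ≤ τ ⁻¹ᵁ g.domain), (U : Set X).Nonempty ∧
      τ.resLE g.domain U hU ≫ g.hom = U.ι ≫ φ ≫ σ.1

end

section

variable {Y : Scheme.{0}} [Y.Over (Spec (.of ℂ))] [IsSmoothProjectiveCurve Y]
  (E : EllipticSurface Y)

/-- Restriction of a section to the generic point of `Y`. -/
noncomputable def sectionToPoint (s : E.Section) : E.Points (RingHom.id (FunctionField Y)) :=
  ⟨genericMap Y ≫ s.1, by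
    rw [Category.assoc, s.2, CommRingCat.ofHom_id, Spec.map_id, Category.id_comp,
      Category.comp_id]⟩

theorem sectionToPoint_bijective : Function.Bijective E.sectionToPoint := by
  constructor
  · intro s t h
    have h' : genericMap Y ≫ s.1 = genericMap Y ≫ t.1 := congrArg Subtype.val h
    exact Subtype.ext (ext_of_isDominant_of_isSeparated E.π (s.2.trans t.2.symm) (genericMap Y) h')
  · intro q
    have hq : q.1 ≫ E.π = genericMap Y := by
      rw [q.2, CommRingCat.ofHom_id, Spec.map_id, Category.id_comp]
    obtain ⟨s, hs, hs'⟩ :=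
      exists_section (fun y ↦ valuationRing_stalk Y (Y ↘ Spec (.of ℂ)) y) E.π q.1 hq
    exact ⟨⟨s, hs⟩, Subtype.ext hs'⟩

/-- Sections of `E` correspond to the rational points of the generic fibre. -/
noncomputable def sectionEquiv : E.Section ≃ E.Points (RingHom.id (FunctionField Y)) :=
  Equiv.ofBijective _ E.sectionToPoint_bijective

/-- The group of sections of `E`: sections are added on the generic fibre. -/
noncomputable instance : AddCommGroup E.Section :=
  E.sectionEquiv.addCommGroup

theorem zeroSection_eq_zero : E.zeroSection = 0 := by
  apply E.sectionEquiv.injective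
  have h : E.sectionEquiv 0 = 0 := E.sectionEquiv.apply_symm_apply _
  rw [h]
  apply Subtype.ext
  change genericMap Y ≫ E.zero = (Spec.map (CommRingCat.ofHom (RingHom.id (FunctionField Y))) ≫
    pullback.lift (genericMap Y ≫ E.zero) (𝟙 _) (by simp [E.zero_π])) ≫ pullback.fst _ _
  rw [CommRingCat.ofHom_id, Spec.map_id, Category.id_comp]
  exact (pullback.lift_fst _ _ _).symm

end

end EllipticSurface

end EllipticDuplication

namespace EllipticDuplication
open scoped TensorProduct

/-! The generic point of `X`, mapped by `τ`, is a point `P` of the generic fibre over `K(X)`. If `σ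
= 2σ'`, the square says `2P = 2φ^*σ'`, so `T = P - φ^*σ'` is killed by 2. The `x`-coordinate of an
affine such `T` is a root of a cubic over `K(Y)`, and `y` is determined by `x`. So `T`, and with it
`P`, is defined over an intermediate field `M` with `[M : K(Y)] ≤ 3`
(`exists_intermediateField_of_two_nsmul_eq_zero`). Generic injectivity of `τ` forces `M = K(X)`,
which has degree 4: a contradiction. The other two claims follow, since the zero section is its own
double.

Two points need work. First, `GenericallyInjective.eq_top`: if `P` is defined over a proper subfield
`M`, then two distinct closed points of `X`, found in the spectrum of `K(X) ⊗[M] K(X)`, have the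
same image under `τ`. Second, `duplication_apply`: `2_E` is only a rational map, prescribed at the
generic point of `E`, and its value at `P` must be shown to be `2P`. The doubling formula, regular
on the local ring of the affine curve at `P`, carries the identity over from the generic point. It
needs `2P ≠ 0`, but `2P = 0` is already excluded by the degree argument applied to `P` itself. -/

/-! ### Separating closed points modulo an intermediate field -/

theorem tmul_sub_tmul_ne_zero {M L : Type*} [Field M] [Field L] [Algebra M L] {θ : L}
    (h : θ ∉ Set.range (algebraMap M L)) : θ ⊗ₜ[M] (1 : L) - 1 ⊗ₜ[M] θ ≠ 0 := by
  intro e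
  have hθ : θ ∉ Submodule.span M {(1 : L)} := by
    rw [Submodule.mem_span_singleton]
    rintro ⟨m, hm⟩
    exact h ⟨m, by rw [← hm, Algebra.smul_def, mul_one]⟩
  -- Take an `M`-linear form `g` with `g 1 = 0` and `g θ ≠ 0`; the map `a ⊗ b ↦ g b • a` sends the
  -- difference to `-g θ`.
  obtain ⟨g, hg, hg'⟩ := Submodule.exists_le_ker_of_notMem hθ
  have hg1 : g 1 = 0 := hg' (Submodule.mem_span_singleton_self 1)
  refine hg ?_
  have := congrArg (TensorProduct.lift (LinearMap.mk₂ M (fun a b : L ↦ g b • a) (by simp)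
    (fun _ _ _ ↦ smul_comm _ _ _) (by simp [add_smul]) (by simp [mul_smul]))) e
  simpa [hg1, Algebra.smul_def] using this

/-- Nullstellensatz: `t` is not nilpotent, so the localization away from `t` is a nonzero algebra of
finite type, and its residue fields at maximal ideals are `k`. -/
theorem exists_algHom_ne_zero {k S : Type*} [Field k] [IsAlgClosed k] [CommRing S] [Algebra k S]
    [Algebra.FiniteType k S] [IsReduced S] {t : S} (ht : t ≠ 0) : ∃ ψ : S →ₐ[k] k, ψ t ≠ 0 := by
  have : Nontrivial (Localization.Away t) := by
    rw [← not_subsingleton_iff_nontrivial]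
    intro h
    obtain ⟨n, hn⟩ := (IsLocalization.subsingleton_iff (M := Submonoid.powers t)
      (S := Localization.Away t)).mp h
    exact ht (eq_zero_of_pow_eq_zero hn)
  have : Algebra.FiniteType k (Localization.Away t) :=
    .trans (S := S) ‹_› (IsLocalization.finiteType_of_monoid_fg (Submonoid.powers t) _)
  obtain ⟨m, hm⟩ := Ideal.exists_maximal (Localization.Away t)
  let _ : Field (Localization.Away t ⧸ m) := Ideal.Quotient.field m
  have : Module.Finite k (Localization.Away t ⧸ m) := finite_of_finite_type_of_isJacobsonRing _ _
  let e : k ≃ₐ[k] Localization.Away t ⧸ m := .ofBijective (Algebra.ofId _ _)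
    IsAlgClosed.algebraMap_bijective_of_isIntegral
  let ψ : S →ₐ[k] Localization.Away t ⧸ m :=
    (Ideal.Quotient.mkₐ k m).comp (IsScalarTower.toAlgHom k S (Localization.Away t))
  refine ⟨(e.symm : _ →ₐ[k] k).comp ψ, ?_⟩
  have hu : IsUnit (ψ t) := (IsLocalization.Away.algebraMap_isUnit t).map (Ideal.Quotient.mkₐ k m)
  exact (hu.map (e.symm : _ →ₐ[k] k)).ne_zero

/-- A `k`-point of the image of `A ⊗[k] A` in `L ⊗[M] L` restricts to two points of `A`. They agree
on elements from `M`, which pass through the tensor sign, and can be chosen to differ at `θ` because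
`θ ⊗ 1 - 1 ⊗ θ` is nonzero in a ring that is reduced by separability. -/
theorem exists_algHom_pair {k A L : Type*} [Field k] [IsAlgClosed k] [CharZero k] [CommRing A]
    [Algebra k A] [Algebra.FiniteType k A] [Field L] [Algebra k L] (i : A →ₐ[k] L)
    (M : IntermediateField k L) [FiniteDimensional M L] {θ : A} (hθ : i θ ∉ M) :
    ∃ ψ₁ ψ₂ : A →ₐ[k] k, ψ₁ θ ≠ ψ₂ θ ∧ ∀ b, i b ∈ M → ψ₁ b = ψ₂ b := by
  have : CharZero M := charZero_of_injective_algebraMap (algebraMap k M).injective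
  have : Algebra.IsSeparable M L := inferInstance
  have : Algebra.FormallyUnramified M L := .of_isSeparable M L
  have : IsReduced (L ⊗[M] L) := Algebra.FormallyUnramified.isReduced_of_field L _
  let h₁ : A →ₐ[k] L ⊗[M] L :=
    ((Algebra.TensorProduct.includeLeft : L →ₐ[M] L ⊗[M] L).restrictScalars k).comp i
  let h₂ : A →ₐ[k] L ⊗[M] L :=
    ((Algebra.TensorProduct.includeRight : L →ₐ[M] L ⊗[M] L).restrictScalars k).comp i
  let h : A ⊗[k] A →ₐ[k] L ⊗[M] L := Algebra.TensorProduct.productMap h₁ h₂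
  have : Algebra.FiniteType k (A ⊗[k] A) := .trans (S := A) ‹_› inferInstance
  -- The image is used because `L ⊗[M] L` itself need not be of finite type over `k`; reducedness
  -- passes to subrings.
  have : Algebra.FiniteType k h.range := .of_surjective h.rangeRestrict h.rangeRestrict_surjective
  have : IsReduced h.range := isReduced_of_injective h.range.val Subtype.val_injective
  have ht : h.rangeRestrict (θ ⊗ₜ 1 - 1 ⊗ₜ θ) ≠ 0 := by
    intro e
    replace e : h (θ ⊗ₜ 1 - 1 ⊗ₜ θ) = 0 := congrArg Subtype.val e
    refine tmul_sub_tmul_ne_zero (M := M) (θ := i θ) ?_ ?_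
    · rintro ⟨m, hm⟩
      exact hθ (hm ▸ m.2)
    · simpa [h, h₁, h₂] using e
  obtain ⟨ψ, hψ⟩ := exists_algHom_ne_zero (k := k) (S := h.range) ht
  let χ := ψ.comp h.rangeRestrict
  replace hψ : χ (θ ⊗ₜ 1 - 1 ⊗ₜ θ) ≠ 0 := hψ
  rw [map_sub] at hψ
  refine ⟨χ.comp Algebra.TensorProduct.includeLeft, χ.comp Algebra.TensorProduct.includeRight,
    sub_ne_zero.mp hψ, fun b hb ↦ ?_⟩
  refine congrArg ψ (Subtype.ext ?_)
  change h (b ⊗ₜ 1) = h (1 ⊗ₜ b)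
  have : i b ⊗ₜ[M] (1 : L) = (1 : L) ⊗ₜ[M] i b :=
    Algebra.TensorProduct.tmul_one_eq_one_tmul (⟨i b, hb⟩ : M)
  simpa [h, h₁, h₂] using this

/-! ### Generically injective morphisms and fields of definition -/

/-- The point of the spectrum of a field. -/
def specPoint (L : Type) [Field L] : Spec (.of L) := IsLocalRing.closedPoint L

theorem genericMap_specPoint (X : Scheme.{0}) [IsIntegral X] :
    genericMap X (specPoint (FunctionField X)) = genericPoint X :=
  X.fromSpecStalk_closedPoint

theorem algHom_eq_of_ker_eq {k A : Type*} [Field k] [CommRing A] [Algebra k A] {ψ₁ ψ₂ : A →ₐ[k] k}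
    (h : RingHom.ker ψ₁ = RingHom.ker ψ₂) : ψ₁ = ψ₂ := by
  ext a
  have : a - algebraMap k A (ψ₁ a) ∈ RingHom.ker ψ₁ := by simp [RingHom.mem_ker]
  rw [h, RingHom.mem_ker, map_sub, AlgHom.commutes, sub_eq_zero] at this
  exact this.symm

theorem exists_specMap_fromSpec_eq {Z : Scheme.{0}} {V : Z.Opens} (hV : IsAffineOpen V) {M : Type}
    [Field M] (q : Spec (.of M) ⟶ Z) (hq : q (specPoint M) ∈ V) :
    ∃ r : Γ(Z, V) ⟶ .of M, Spec.map r ≫ hV.fromSpec = q := by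
  have hr : Set.range q ⊆ Set.range hV.fromSpec := by
    rw [hV.range_fromSpec]
    rintro _ ⟨z, rfl⟩
    rwa [Subsingleton.elim z (specPoint M)]
  refine ⟨Spec.preimage (IsOpenImmersion.lift hV.fromSpec q hr), ?_⟩
  rw [Spec.map_preimage, IsOpenImmersion.lift_fac]

/-- On affine opens, functions pulled back along `τ` land in `M`. If `M` were proper, the two
`ℂ`-points from `exists_algHom_pair` would be distinct points of `U` with the same image. -/
theorem GenericallyInjective.eq_top {X Z : Scheme.{0}} [IsIntegral X] (s : X ⟶ Spec (.of ℂ))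
    [LocallyOfFiniteType s] {τ : X ⟶ Z} (hτ : GenericallyInjective τ)
    [Algebra ℂ (FunctionField X)]
    (hs : genericMap X ≫ s = Spec.map (CommRingCat.ofHom (algebraMap ℂ (FunctionField X))))
    (M : IntermediateField ℂ (FunctionField X)) [FiniteDimensional M (FunctionField X)]
    (q : Spec (.of M) ⟶ Z)
    (hq : genericMap X ≫ τ = Spec.map (CommRingCat.ofHom (algebraMap M (FunctionField X))) ≫ q) :
    M = ⊤ := by
  by_contra hM
  obtain ⟨U, hU, hinj⟩ := hτ
  have hηU : genericPoint X ∈ U := ((genericPoint_spec X).mem_open_set_iff U.2).mpr (by simpa using hU)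
  obtain ⟨V', hV', hηV', -⟩ :=
    exists_isAffineOpen_mem_and_subset (x := τ (genericPoint X)) (U := ⊤) trivial
  obtain ⟨V, hV, hηV, hVU⟩ := exists_isAffineOpen_mem_and_subset (x := genericPoint X)
    (U := U ⊓ τ ⁻¹ᵁ V') ⟨hηU, hηV'⟩
  have : Nonempty V := ⟨_, hηV⟩
  let i : Γ(X, V) ⟶ .of (FunctionField X) := X.presheaf.germ V (genericPoint X) hηV
  have hi : Spec.map i ≫ hV.fromSpec = genericMap X := hV.fromSpecStalk_eq_fromSpecStalk hηV
  obtain ⟨c, hc⟩ : ∃ c : .of ℂ ⟶ Γ(X, V), Spec.map c = hV.fromSpec ≫ s :=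
    Spec.map_surjective _
  let _ : Algebra ℂ Γ(X, V) := c.hom.toAlgebra
  have : Algebra.FiniteType ℂ Γ(X, V) := by
    have h : LocallyOfFiniteType (Spec.map c) := by rw [hc]; infer_instance
    exact (HasRingHomProperty.Spec_iff (P := @LocallyOfFiniteType)).mp h
  have hic : c ≫ i = CommRingCat.ofHom (algebraMap ℂ (FunctionField X)) := by
    apply Spec.map_injective
    rw [Spec.map_comp, hc, ← Category.assoc, hi, hs]
  let ia : Γ(X, V) →ₐ[ℂ] FunctionField X :=
    { i.hom with commutes' := fun z ↦ congrArg (fun g ↦ g.hom z) hic }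
  obtain ⟨r, hr⟩ := exists_specMap_fromSpec_eq hV' q (by
    have h := congrArg (fun g ↦ g (specPoint (FunctionField X))) hq
    simp only [Scheme.Hom.comp_apply, genericMap_specPoint] at h
    rw [Subsingleton.elim (specPoint M) _, ← h]
    exact hηV')
  have hle : V ≤ τ ⁻¹ᵁ V' := fun z hz ↦ (hVU hz).2
  have hri : τ.appLE V' V hle ≫ i = r ≫ CommRingCat.ofHom (algebraMap M (FunctionField X)) := by
    apply Spec.map_injective
    rw [Spec.map_comp, Spec.map_comp, ← cancel_mono hV'.fromSpec, Category.assoc, Category.assoc,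
      hr, IsAffineOpen.SpecMap_appLE_fromSpec τ hV' hV hle, ← hq, ← hi, Category.assoc]
  -- `K(X)` is the fraction field of `Γ(X, V)`, so the latter cannot lie in a proper subfield.
  obtain ⟨θ, hθ⟩ : ∃ θ, ia θ ∉ M := by
    by_contra! h
    refine hM (eq_top_iff.mpr fun x _ ↦ ?_)
    have := functionField_isFractionRing_of_isAffineOpen X V hV
    obtain ⟨a, b, -, rfl⟩ := IsFractionRing.div_surjective (A := Γ(X, V)) (K := X.functionField) x
    exact div_mem (h a) (h b)
  obtain ⟨ψ₁, ψ₂, hne, heq⟩ := exists_algHom_pair ia M hθ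
  let x (ψ : Γ(X, V) →ₐ[ℂ] ℂ) : Spec (.of ℂ) ⟶ X :=
    Spec.map (CommRingCat.ofHom (ψ : Γ(X, V) →+* ℂ)) ≫ hV.fromSpec
  have hx (ψ) : x ψ ≫ τ =
      Spec.map (τ.appLE V' V hle ≫ CommRingCat.ofHom (ψ : Γ(X, V) →+* ℂ)) ≫ hV'.fromSpec := by
    rw [Spec.map_comp, Category.assoc, Category.assoc,
      IsAffineOpen.SpecMap_appLE_fromSpec τ hV' hV hle]
  have hxx : x ψ₁ ≫ τ = x ψ₂ ≫ τ := by
    rw [hx, hx]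
    congr 2
    ext b
    refine heq _ ?_
    -- By `hri` the pullback of `b` lies in `M`, where the two points agree.
    have := congrArg (fun g ↦ g.hom b) hri
    exact this ▸ (r.hom b).2
  have hmem (ψ) (z) : x ψ z ∈ U := by
    refine (hVU ?_).1
    change _ ∈ (V : Set X)
    rw [← hV.range_fromSpec]
    exact ⟨_, (Scheme.Hom.comp_apply _ _ _).symm⟩
  have hpt := hinj (hmem ψ₁ (specPoint ℂ)) (hmem ψ₂ (specPoint ℂ)) (by
    rw [← Scheme.Hom.comp_apply, hxx, Scheme.Hom.comp_apply])
  simp only [x, Scheme.Hom.comp_apply] at hpt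
  have hpt := congrArg PrimeSpectrum.asIdeal (hV.fromSpec.isOpenEmbedding.injective hpt)
  refine hne (DFunLike.congr_fun (algHom_eq_of_ker_eq ?_) θ)
  have hk (ψ : Γ(X, V) →ₐ[ℂ] ℂ) : (Spec.map (CommRingCat.ofHom (ψ : Γ(X, V) →+* ℂ))
      (specPoint ℂ)).asIdeal = RingHom.ker ψ := by
    change Ideal.comap (ψ : Γ(X, V) →+* ℂ) (IsLocalRing.maximalIdeal ℂ) = _
    rw [IsLocalRing.maximalIdeal_eq_bot]
    rfl
  exact (hk ψ₁).symm.trans (hpt.trans (hk ψ₂))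


/-! ### Coordinate functions and base change of points -/

section
variable {K : Type} [Field K] (W : WeierstrassCurve K)

/-- The first coordinate function. -/
noncomputable def coordX : W.toAffine.CoordinateRing := AdjoinRoot.of _ Polynomial.X

/-- The second coordinate function. -/
noncomputable def coordY : W.toAffine.CoordinateRing := AdjoinRoot.root _

variable {L : Type} [Field L] (f : K →+* L)

@[simp]
theorem evalHom_coordX {x y : L} (h : (W.map f).toAffine.Equation x y) :
    evalHom W f h (coordX W) = x := by
  simp [evalHom, coordX]

@[simp]
theorem evalHom_coordY {x y : L} (h : (W.map f).toAffine.Equation x y) :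
    evalHom W f h (coordY W) = y := by
  simp [evalHom, coordY]

@[simp]
theorem evalHom_algebraMap {x y : L} (h : (W.map f).toAffine.Equation x y) (a : K) :
    evalHom W f h (algebraMap K _ a) = f a := by
  simp [evalHom, IsScalarTower.algebraMap_apply K (Polynomial K) W.toAffine.CoordinateRing]

theorem coordinateRing_hom_ext {S : Type*} [CommRing S] {g₁ g₂ : W.toAffine.CoordinateRing →+* S}
    (h : ∀ a : K, g₁ (algebraMap K _ a) = g₂ (algebraMap K _ a))
    (hX : g₁ (coordX W) = g₂ (coordX W)) (hY : g₁ (coordY W) = g₂ (coordY W)) : g₁ = g₂ := by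
  apply AdjoinRoot.ringHom_ext
  · ext a
    · exact h a
    · exact hX
  · exact hY

variable {W} in
open Classical in
/-- The map on points induced by an extension of fields. -/
noncomputable def pointMap {M : Type} [Field M] [Algebra K M] [Algebra K L] (g : M →ₐ[K] L)
    (P : (W.map (algebraMap K M)).toAffine.Point) : (W.map (algebraMap K L)).toAffine.Point :=
  WeierstrassCurve.Affine.Point.map g P

section
variable {M : Type} [Field M] [Algebra K M] [Algebra K L] (g : M →ₐ[K] L)

theorem pointMap_zero : pointMap g (0 : (W.map (algebraMap K M)).toAffine.Point) = 0 := rfl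

variable [DecidableEq M] [DecidableEq L]

theorem pointMap_add (P Q : (W.map (algebraMap K M)).toAffine.Point) :
    pointMap g (P + Q) = pointMap g P + pointMap g Q :=
  map_add (WeierstrassCurve.Affine.Point.map (W' := W.toAffine) g) P Q

theorem pointMap_nsmul (n : ℕ) (P : (W.map (algebraMap K M)).toAffine.Point) :
    pointMap g (n • P) = n • pointMap g P :=
  map_nsmul (WeierstrassCurve.Affine.Point.map (W' := W.toAffine) g) n P

end

theorem pointMap_pointMap {M N : Type} [Field M] [Field N] [Algebra K M] [Algebra K N]
    [Algebra K L] (g : M →ₐ[K] L) (g' : L →ₐ[K] N) (P : (W.map (algebraMap K M)).toAffine.Point) :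
    pointMap g' (pointMap g P) = pointMap (g'.comp g) P :=
  by classical exact WeierstrassCurve.Affine.Point.map_map _ _ _

variable {W} in
theorem pointHom_map {C : Scheme.{0}} (o : Spec (.of K) ⟶ C) (chart : affineCurve W ⟶ C)
    {M : Type} [Field M] [Algebra K M] [Algebra K L]
    (g : M →ₐ[K] L) (P : (W.map (algebraMap K M)).toAffine.Point) :
    pointHom (algebraMap K L) o chart (pointMap g P) =
      Spec.map (CommRingCat.ofHom (g : M →+* L)) ≫ pointHom (algebraMap K M) o chart P := by
  match P with
  | .zero =>
    change Spec.map _ ≫ o = _ ≫ Spec.map _ ≫ o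
    rw [← Category.assoc, ← Spec.map_comp, ← CommRingCat.ofHom_comp, AlgHom.comp_algebraMap]
  | .some x y h =>
    change evalPoint W _ _ ≫ chart = _ ≫ evalPoint W _ _ ≫ chart
    rw [← Category.assoc]
    congr 1
    refine Eq.trans (congrArg Spec.map ?_) (Spec.map_comp _ _)
    rw [← CommRingCat.ofHom_comp]
    congr 1
    apply coordinateRing_hom_ext <;> simp

end

/-! ### Fields of definition of 2-torsion points -/

section
variable {K L : Type} [Field K] [Field L] [Algebra K L]
  (W : WeierstrassCurve K)

open Classical in
theorem two_nsmul_some_eq_zero {x y : L} {h : (W.map (algebraMap K L)).toAffine.Nonsingular x y}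
    (h2 : 2 • WeierstrassCurve.Affine.Point.some x y h = 0) :
    y = (W.map (algebraMap K L)).toAffine.negY x y := by
  by_contra hy
  rw [two_nsmul, WeierstrassCurve.Affine.Point.add_self_of_Y_ne hy] at h2
  exact WeierstrassCurve.Affine.Point.some_ne_zero _ h2

open Classical in
-- An affine point killed by 2 has `2y + a₁x + a₃ = 0`, so `x` is a root of the 2-torsion cubic, and
-- `y ∈ K(x)` because 2 is invertible.
theorem exists_intermediateField_of_two_nsmul_eq_zero [CharZero K]
    (T : (W.map (algebraMap K L)).toAffine.Point)
    (hT : 2 • T = 0) : ∃ M : IntermediateField K L, Module.finrank K M ≤ 3 ∧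
      ∃ T' : (W.map (algebraMap K M)).toAffine.Point,
        pointMap M.val T' = T := by
  match T with
  | .zero => exact ⟨⊥, by simp, 0, rfl⟩
  | .some x y h =>
    have hL : CharZero L := charZero_of_injective_algebraMap (algebraMap K L).injective
    have hy := two_nsmul_some_eq_zero W hT
    simp only [WeierstrassCurve.Affine.negY, WeierstrassCurve.map_a₁,
      WeierstrassCurve.map_a₃] at hy
    have hroot : Polynomial.aeval x W.twoTorsionPolynomial.toPoly = 0 := by
      have he := (WeierstrassCurve.Affine.equation_iff _ _).mp h.1
      simp only [WeierstrassCurve.map_a₁, WeierstrassCurve.map_a₂, WeierstrassCurve.map_a₃,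
        WeierstrassCurve.map_a₄, WeierstrassCurve.map_a₆] at he
      simp only [WeierstrassCurve.twoTorsionPolynomial, Cubic.toPoly, WeierstrassCurve.b₂,
        WeierstrassCurve.b₄, WeierstrassCurve.b₆, map_add, map_mul, map_pow, Polynomial.aeval_C,
        Polynomial.aeval_X, map_ofNat]
      -- On the curve the cubic equals `(2y + a₁x + a₃)²`.
      linear_combination -4 * he + (2 * y + algebraMap K L W.a₁ * x + algebraMap K L W.a₃) * hy
    have h4 : W.twoTorsionPolynomial.a ≠ 0 := by
      change (4 : K) ≠ 0
      exact_mod_cast (Nat.cast_ne_zero (R := K)).mpr four_ne_zero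
    have hx : IsIntegral K x := isAlgebraic_iff_isIntegral.mp
      ⟨_, Cubic.ne_zero_of_a_ne_zero h4, hroot⟩
    let M := IntermediateField.adjoin K {x}
    have hxM : x ∈ M := IntermediateField.mem_adjoin_simple_self K x
    have hyM : y ∈ M := by
      have : y = (- algebraMap K L W.a₁ * x - algebraMap K L W.a₃) / 2 := by
        field_simp
        linear_combination hy
      rw [this]
      exact div_mem (sub_mem (mul_mem (neg_mem (M.algebraMap_mem _)) hxM) (M.algebraMap_mem _))
        (ofNat_mem M 2)
    refine ⟨M, ?_, .some (⟨x, hxM⟩ : M) (⟨y, hyM⟩ : M)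
      ((WeierstrassCurve.Affine.baseChange_nonsingular W M.val.injective _ _).mp h), rfl⟩
    rw [IntermediateField.adjoin.finrank hx]
    exact (Polynomial.natDegree_le_of_dvd (minpoly.dvd K x hroot)
      (Cubic.ne_zero_of_a_ne_zero h4)).trans (Cubic.natDegree_of_a_ne_zero h4).le
end

/-! ### The doubling formula over a ring -/

section

variable {K : Type} [Field K] (W : WeierstrassCurve K)

/-- Writing the slope with an inverse `u` instead of a division makes the formula meaningful over
any ring where `2y + a₁x + a₃` is a unit. -/
theorem two_nsmul_some {L : Type} [Field L] [DecidableEq L] (W : WeierstrassCurve L) {x y u : L}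
    (h : W.toAffine.Nonsingular x y) (hu : (2 * y + W.a₁ * x + W.a₃) * u = 1) :
    ∃ h', 2 • WeierstrassCurve.Affine.Point.some x y h =
      WeierstrassCurve.Affine.Point.some
        (W.toAffine.addX x x ((3 * x ^ 2 + 2 * W.a₂ * x + W.a₄ - W.a₁ * y) * u))
        (W.toAffine.addY x x y ((3 * x ^ 2 + 2 * W.a₂ * x + W.a₄ - W.a₁ * y) * u)) h' := by
  have hd : y - W.toAffine.negY x y = 2 * y + W.a₁ * x + W.a₃ := by
    rw [WeierstrassCurve.Affine.negY]; ring
  have hy : y ≠ W.toAffine.negY x y := by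
    rw [← sub_ne_zero, hd]
    exact left_ne_zero_of_mul_eq_one hu
  have hs : W.toAffine.slope x x y y = (3 * x ^ 2 + 2 * W.a₂ * x + W.a₄ - W.a₁ * y) * u := by
    rw [WeierstrassCurve.Affine.slope_of_Y_ne rfl hy, hd, div_eq_mul_inv,
      inv_eq_of_mul_eq_one_right hu]
  rw [← hs, two_nsmul, WeierstrassCurve.Affine.Point.add_self_of_Y_ne hy]
  exact ⟨_, rfl⟩

/-- The function `2y + a₁x + a₃`, which vanishes at the affine points of order two. -/
noncomputable def coordD : W.toAffine.CoordinateRing :=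
  2 * coordY W + algebraMap K _ W.a₁ * coordX W + algebraMap K _ W.a₃

theorem evalHom_coordD {L : Type} [Field L] (f : K →+* L) {x y : L}
    (h : (W.map f).toAffine.Equation x y) :
    evalHom W f h (coordD W) = 2 * y + (W.map f).a₁ * x + (W.map f).a₃ := by
  simp [coordD, map_ofNat (evalHom W f h) 2]

open Classical in
-- One homomorphism `δ` gives the double simultaneously at every field-valued point of `O`. It will
-- be compared at the generic point and at the closed point of a local ring.
theorem exists_double {O F : Type} [CommRing O] [Field F] (ρ : W.toAffine.CoordinateRing →+* O)
    (hD : IsUnit (ρ (coordD W))) (ι : O →+* F) (hι : Function.Injective ι) (fF : K →+* F) {xF yF : F}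
    (hF : (W.map fF).toAffine.Nonsingular xF yF) (hιρ : ι.comp ρ = evalHom W fF hF.1) :
    ∃ δ : W.toAffine.CoordinateRing →+* O, ∀ {L : Type} [Field L] (κ : O →+* L) (f : K →+* L)
      {x y : L} (h : (W.map f).toAffine.Nonsingular x y), κ.comp ρ = evalHom W f h.1 →
      ∃ (x' y' : L) (h' : (W.map f).toAffine.Nonsingular x' y'),
        2 • WeierstrassCurve.Affine.Point.some x y h = .some x' y' h' ∧
          κ.comp δ = evalHom W f h'.1 := by
  obtain ⟨u, hu⟩ := hD.exists_right_inv
  let a : K →+* O := ρ.comp (algebraMap K _)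
  let ℓ : O := (3 * ρ (coordX W) ^ 2 + 2 * (W.map a).a₂ * ρ (coordX W) + (W.map a).a₄ -
    (W.map a).a₁ * ρ (coordY W)) * u
  let X' : O := (W.map a).toAffine.addX (ρ (coordX W)) (ρ (coordX W)) ℓ
  let Y' : O := (W.map a).toAffine.addY (ρ (coordX W)) (ρ (coordX W)) (ρ (coordY W)) ℓ
  have key {L : Type} [Field L] (κ : O →+* L) (f : K →+* L)
      {x y : L} (h : (W.map f).toAffine.Nonsingular x y) (e : κ.comp ρ = evalHom W f h.1) :
      κ.comp a = f ∧ ∃ h' : (W.map f).toAffine.Nonsingular (κ X') (κ Y'),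
        2 • WeierstrassCurve.Affine.Point.some x y h = .some (κ X') (κ Y') h' := by
    have e' (r) : κ (ρ r) = evalHom W f h.1 r := DFunLike.congr_fun e r
    have ha : κ.comp a = f := by
      ext z
      simp [a, e']
    refine ⟨ha, ?_⟩
    have hu' : (2 * y + (W.map f).a₁ * x + (W.map f).a₃) * κ u = 1 := by
      rw [← evalHom_coordD W f h.1, ← e', ← map_mul, hu, map_one]
    have hℓ : κ ℓ = (3 * x ^ 2 + 2 * (W.map f).a₂ * x + (W.map f).a₄ - (W.map f).a₁ * y) * κ u := by
      simp [ℓ, a, e', map_ofNat κ 2, map_ofNat κ 3]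
    have hW : (W.map a).map κ = W.map f := by rw [WeierstrassCurve.map_map, ha]
    have hX' : κ X' = (W.map f).toAffine.addX x x (κ ℓ) := by
      refine (WeierstrassCurve.Affine.map_addX (W' := (W.map a).toAffine) κ _ _ _).symm.trans ?_
      rw [e', evalHom_coordX]
      exact congrArg (fun V : WeierstrassCurve L ↦ V.toAffine.addX x x (κ ℓ)) hW
    have hY' : κ Y' = (W.map f).toAffine.addY x x y (κ ℓ) := by
      refine (WeierstrassCurve.Affine.map_addY (W' := (W.map a).toAffine) κ _ _ _ _).symm.trans ?_
      rw [e', e', evalHom_coordX, evalHom_coordY]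
      exact congrArg (fun V : WeierstrassCurve L ↦ V.toAffine.addY x x y (κ ℓ)) hW
    rw [hX', hY', hℓ]
    exact two_nsmul_some (W.map f) h hu'
  -- The doubled coordinates satisfy the equation in `O` because they do so in the field `F`, into
  -- which `O` injects.
  have hpoly : W.toAffine.polynomial.eval₂ (Polynomial.eval₂RingHom a X') Y' = 0 := by
    apply hι
    obtain ⟨ha, h', -⟩ := key ι fF hF hιρ
    rw [map_zero, Polynomial.hom_eval₂]
    have : ι.comp (Polynomial.eval₂RingHom a X') = Polynomial.eval₂RingHom fF (ι X') := by
      ext z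
      · simp [← ha]
      · simp
    rw [this, eval₂_polynomial_eq]
    exact h'.1
  refine ⟨AdjoinRoot.lift (Polynomial.eval₂RingHom a X') Y' hpoly, fun κ f _ _ h e ↦ ?_⟩
  obtain ⟨ha, h', h2⟩ := key κ f h e
  refine ⟨_, _, h', h2, ?_⟩
  apply coordinateRing_hom_ext
  · intro z
    refine Eq.trans ?_ (evalHom_algebraMap W f h'.1 z).symm
    simp [← ha, IsScalarTower.algebraMap_apply K (Polynomial K) W.toAffine.CoordinateRing]
  · simp [coordX]
    simp [evalHom]
  · simp [coordY]
    simp [evalHom]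
end


/-! ### Generic points of open subsets and spectra of local rings -/

theorem isDominant_specMap {R S : Type} [CommRing R] [CommRing S] {i : R →+* S}
    (hi : Function.Injective i) : IsDominant (Spec.map (CommRingCat.ofHom i)) := by
  refine ⟨(PrimeSpectrum.denseRange_comap_iff_ker_le_nilRadical i).mpr ?_⟩
  rw [(RingHom.injective_iff_ker_eq_bot i).mp hi]
  exact bot_le

instance (Y : Scheme.{0}) [IsIntegral Y] : IsPreimmersion (genericMap Y) :=
  inferInstanceAs (IsPreimmersion (Y.fromSpecStalk (genericPoint Y)))

theorem genericPoint_mem {X : Scheme.{0}} [IsIntegral X] {U : X.Opens} (hU : (U : Set X).Nonempty) :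
    genericPoint X ∈ U :=
  ((genericPoint_spec X).mem_open_set_iff U.2).mpr (by simpa using hU)

/-- The inclusion of the generic point in an open subset. -/
noncomputable def genericLift {X : Scheme.{0}} [IsIntegral X] {U : X.Opens}
    (hU : (U : Set X).Nonempty) : Spec (.of (FunctionField X)) ⟶ U :=
  U.fromSpecStalkOfMem (genericPoint X) (genericPoint_mem hU)

@[simp]
theorem genericLift_ι {X : Scheme.{0}} [IsIntegral X] {U : X.Opens} (hU : (U : Set X).Nonempty) :
    genericLift hU ≫ U.ι = genericMap X :=
  Scheme.Opens.fromSpecStalkOfMem_ι ..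

instance {X : Scheme.{0}} [IsIntegral X] {U : X.Opens} (hU : (U : Set X).Nonempty) :
    IsDominant (genericLift hU) := by
  refine ⟨((genericMap X).denseRange.preimage U.ι.isOpenEmbedding.isOpenMap).mono ?_⟩
  rintro u ⟨z, hz⟩
  refine ⟨z, U.ι.isOpenEmbedding.injective ?_⟩
  rw [← hz, ← Scheme.Hom.comp_apply, genericLift_ι]

/-- The morphism of spectra induced by a ring homomorphism. -/
noncomputable def specHom {S T : Type} [CommRing S] [CommRing T] (i : S →+* T) :
    Spec (.of T) ⟶ Spec (.of S) := Spec.map (CommRingCat.ofHom i)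

/-- The point of the affine curve with values in a ring. -/
noncomputable def ringPoint {K : Type} [Field K] {W : WeierstrassCurve K} {S : Type} [CommRing S]
    (i : W.toAffine.CoordinateRing →+* S) : Spec (.of S) ⟶ affineCurve W :=
  Spec.map (CommRingCat.ofHom i)

theorem specHom_ringPoint {K : Type} [Field K] {W : WeierstrassCurve K} {S T : Type} [CommRing S]
    [CommRing T] (i : W.toAffine.CoordinateRing →+* S) (j : S →+* T) :
    specHom j ≫ ringPoint i = ringPoint (j.comp i) :=
  (Spec.map_comp _ _).symm

theorem specHom_closedPoint {O L : Type} [CommRing O] [IsLocalRing O] [Field L] (κ : O →+* L)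
    [IsLocalHom κ] : specHom κ (specPoint L) = IsLocalRing.closedPoint O :=
  IsLocalRing.comap_closedPoint κ

theorem isLocalHom_lift {R L : Type} [CommRing R] [Field L] (e : R →+* L) (𝔭 : Ideal R) [𝔭.IsPrime]
    (h : RingHom.ker e = 𝔭) (hu : ∀ s : 𝔭.primeCompl, IsUnit (e s)) :
    IsLocalHom (IsLocalization.lift hu : Localization.AtPrime 𝔭 →+* L) := by
  refine ⟨fun a ha ↦ ?_⟩
  obtain ⟨r, s, rfl⟩ := IsLocalization.exists_mk'_eq 𝔭.primeCompl a
  rw [IsLocalization.lift_mk'] at ha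
  have hr : r ∈ 𝔭.primeCompl := fun hr ↦ by
    rw [← h] at hr
    rw [(RingHom.mem_ker).mp hr, zero_mul] at ha
    exact not_isUnit_zero ha
  exact (IsLocalization.AtPrime.isUnit_mk'_iff _ 𝔭 r s).mpr hr

/-! ### Values of the duplication map -/

namespace EllipticSurface
variable {Y : Scheme.{0}} [Y.Over (Spec (.of ℂ))] [IsIntegral Y] (E : EllipticSurface Y)

/-- The zero of the generic fibre. -/
noncomputable def genericZero : Spec (.of (FunctionField Y)) ⟶ pullback E.π (genericMap Y) :=
  pullback.lift (genericMap Y ≫ E.zero) (𝟙 _) (by simp [E.zero_π])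

/-- The affine Weierstrass curve of the generic fibre, mapped to the surface. -/
noncomputable def chartMap : affineCurve E.weierstrass ⟶ E.carrier :=
  E.chart ≫ pullback.fst _ _

theorem pointEquiv_coe {L : Type} [Field L] (f : FunctionField Y →+* L)
    (P : (E.weierstrass.map f).toAffine.Point) :
    (E.pointEquiv f P).1 = pointHom f E.genericZero E.chart P ≫ pullback.fst _ _ := rfl

theorem pointEquiv_some_coe {L : Type} [Field L] (f : FunctionField Y →+* L) {x y : L}
    (h : (E.weierstrass.map f).toAffine.Nonsingular x y) :
    (E.pointEquiv f (.some x y h)).1 = ringPoint (evalHom _ f h.1) ≫ E.chartMap :=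
  Category.assoc _ _ _

/-- The generic point of the surface specializes to every point, in particular to the generic point
of the chart. So it lies in the open chart and corresponds there to the zero ideal, whence the
injectivity. -/
theorem exists_tautologicalPoint_eq : ∃ (x y : FunctionField E.carrier)
    (h : (E.weierstrass.map (functionFieldMap E.π)).toAffine.Nonsingular x y),
    E.pointEquiv _ (.some x y h) = E.tautologicalPoint ∧
      Function.Injective (evalHom E.weierstrass _ h.1) := by
  have hc := E.isWeierstrassChart
  have := hc.isOpenImmersion
  obtain ⟨Q, hQ⟩ := (E.pointEquiv _).surjective E.tautologicalPoint
  let c₀ : affineCurve E.weierstrass := (⊥ : PrimeSpectrum E.weierstrass.toAffine.CoordinateRing)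
  have hz : pointHom _ E.genericZero E.chart Q (specPoint (FunctionField E.carrier)) ⤳
      E.chart c₀ := by
    rw [← (IsPreimmersion.isEmbedding (pullback.fst E.π (genericMap Y))).isInducing.specializes_iff]
    have : pullback.fst E.π (genericMap Y)
        (pointHom _ E.genericZero E.chart Q (specPoint _)) = genericPoint E.carrier := by
      rw [← genericMap_specPoint, ← Scheme.Hom.comp_apply, ← pointEquiv_coe, hQ]
      rfl
    rw [this]
    exact genericPoint_specializes _
  have hzr : pointHom _ E.genericZero E.chart Q (specPoint _) ∈ Set.range E.chart :=
    hz.mem_open E.chart.isOpenEmbedding.isOpen_range ⟨_, rfl⟩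
  match Q, hQ, hz, hzr with
  | .zero, _, _, hzr =>
    rw [hc.range_chart] at hzr
    exact (hzr ⟨_, (Scheme.Hom.comp_apply (specHom _) E.genericZero (specPoint _)).symm⟩).elim
  | .some x y h, hQ, hz, _ =>
    refine ⟨x, y, h, hQ, ?_⟩
    have hz' : E.chart (evalPoint _ _ h.1 (specPoint _)) ⤳ E.chart c₀ := by
      convert hz using 1
      exact (Scheme.Hom.comp_apply _ _ _).symm
    rw [E.chart.isOpenEmbedding.isInducing.specializes_iff] at hz'
    have hle := (PrimeSpectrum.le_iff_specializes _ _).mpr hz'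
    rw [RingHom.injective_iff_ker_eq_bot, eq_bot_iff]
    intro r hr
    refine hle (?_ : evalHom E.weierstrass _ h.1 r ∈ IsLocalRing.maximalIdeal _)
    rw [(RingHom.mem_ker).mp hr]
    exact zero_mem _

theorem genericLift_duplication {g : E.carrier.PartialMap E.carrier}
    (hg : g.toRationalMap = E.duplication) :
    genericLift g.dense_domain.nonempty ≫ g.hom = (2 • E.tautologicalPoint).1 := by
  change g.fromFunctionField = _
  rw [← Scheme.RationalMap.fromFunctionField_toRationalMap, hg]
  exact Scheme.RationalMap.fromFunctionField_ofFunctionField ..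

open Classical in
theorem pointEquiv_nsmul {L : Type} [Field L] (f : FunctionField Y →+* L) (n : ℕ)
    (P : (E.weierstrass.map f).toAffine.Point) :
    E.pointEquiv f (n • P) = n • E.pointEquiv f P :=
  map_nsmul ((E.pointEquiv f).symm.addEquiv).symm n P

open Classical in
-- Let `O` be the local ring of the affine curve at the given point. Both `g` and the doubling
-- formula define morphisms from `Spec O` to the surface; they agree at the generic point by the
-- definition of `2_E`, hence everywhere by separatedness, in particular at the closed point.
theorem duplication_apply [Y.IsSeparated] {g : E.carrier.PartialMap E.carrier}
    (hg : g.toRationalMap = E.duplication) {L : Type} [Field L] (f : FunctionField Y →+* L) {x y : L}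
    (h : (E.weierstrass.map f).toAffine.Nonsingular x y)
    (hD : evalHom E.weierstrass f h.1 (coordD _) ≠ 0) (p : Spec (.of L) ⟶ g.domain)
    (hp : p ≫ g.domain.ι = (E.pointEquiv f (.some x y h)).1) :
    p ≫ g.hom = (E.pointEquiv f (2 • .some x y h)).1 := by
  have : E.carrier.IsSeparated := ⟨by
    rw [← terminal.comp_from E.π]
    infer_instance⟩
  obtain ⟨xF, yF, hF, hQ, hinj⟩ := E.exists_tautologicalPoint_eq
  have hQ' : ringPoint (evalHom _ _ hF.1) ≫ E.chartMap = genericMap E.carrier := by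
    rw [← E.pointEquiv_some_coe _ hF, hQ]
    rfl
  let R := E.weierstrass.toAffine.CoordinateRing
  let 𝔭 := RingHom.ker (evalHom E.weierstrass f h.1)
  have : 𝔭.IsPrime := RingHom.ker_isPrime _
  let O := Localization.AtPrime 𝔭
  let ρ : R →+* O := algebraMap R O
  let κ : O →+* L := IsLocalization.lift (M := 𝔭.primeCompl) (g := evalHom E.weierstrass f h.1)
    (fun s ↦ isUnit_iff_ne_zero.mpr s.2)
  have : IsLocalHom κ := isLocalHom_lift _ 𝔭 rfl _
  have hκ : κ.comp ρ = evalHom E.weierstrass f h.1 := IsLocalization.lift_comp _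
  have hle : 𝔭.primeCompl ≤ nonZeroDivisors R := 𝔭.primeCompl_le_nonZeroDivisors
  let ι : O →+* FunctionField E.carrier := IsLocalization.lift (M := 𝔭.primeCompl)
    (g := evalHom E.weierstrass _ hF.1) (fun s ↦ isUnit_iff_ne_zero.mpr
      ((map_ne_zero_iff _ hinj).mpr (nonZeroDivisors.ne_zero (hle s.2))))
  have hι : ι.comp ρ = evalHom E.weierstrass _ hF.1 := IsLocalization.lift_comp _
  have hιinj : Function.Injective ι := by
    refine (IsLocalization.lift_injective_iff _).mpr fun a b ↦ ?_
    rw [(IsLocalization.injective O hle).eq_iff, hinj.eq_iff]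
  have : IsDominant (specHom ι) := isDominant_specMap hιinj
  obtain ⟨δ, hδ⟩ := exists_double E.weierstrass ρ
    (IsLocalization.map_units O (⟨coordD _, hD⟩ : 𝔭.primeCompl)) ι hιinj _ hF hι
  let j : Spec (.of O) ⟶ E.carrier := ringPoint ρ ≫ E.chartMap
  have hκj : specHom κ ≫ j = p ≫ g.domain.ι := by
    rw [hp, pointEquiv_some_coe, ← Category.assoc, specHom_ringPoint, hκ]
  have hιj : specHom ι ≫ j = genericMap E.carrier := by
    rw [← hQ', ← Category.assoc, specHom_ringPoint, hι]
  -- An open set containing the image of the closed point contains the image of all of `Spec O`.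
  have hj : Set.range j ⊆ Set.range g.domain.ι := by
    have h1 : j (IsLocalRing.closedPoint O) ∈ g.domain := by
      have := congrArg (fun k ↦ k (specPoint L)) hκj
      simp only [Scheme.Hom.comp_apply] at this
      rw [← specHom_closedPoint κ]
      refine this ▸ (p (specPoint L)).2
    rw [Scheme.Opens.range_ι]
    rintro _ ⟨z, rfl⟩
    change z ∈ j ⁻¹ᵁ g.domain
    rw [Scheme.preimage_eq_top_of_closedPoint_mem j h1]
    trivial
  let j' : Spec (.of O) ⟶ g.domain := IsOpenImmersion.lift g.domain.ι j hj
  have hj' : j' ≫ g.domain.ι = j := IsOpenImmersion.lift_fac _ _ _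
  have key : j' ≫ g.hom = ringPoint δ ≫ E.chartMap := by
    refine ext_of_isDominant (specHom ι) ?_
    obtain ⟨x', y', h', h2, e⟩ := hδ ι _ hF hι
    have h1 : specHom ι ≫ j' = genericLift g.dense_domain.nonempty := by
      rw [← cancel_mono g.domain.ι, Category.assoc, hj', hιj, genericLift_ι]
    rw [← Category.assoc, ← Category.assoc, h1, specHom_ringPoint, e,
      E.genericLift_duplication hg, ← hQ, ← pointEquiv_nsmul, h2, pointEquiv_some_coe]
  have hp' : specHom κ ≫ j' = p := by
    rw [← cancel_mono g.domain.ι, Category.assoc, hj', hκj]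
  obtain ⟨x', y', h', h2, e⟩ := hδ κ f h hκ
  rw [← hp', Category.assoc, key, ← Category.assoc, specHom_ringPoint, e, h2, pointEquiv_some_coe]

/-- This is what shows that `τ` lies over `φ` generically, which the square does not assume. -/
theorem duplication_hom_π [Y.IsSeparated] {g : E.carrier.PartialMap E.carrier}
    (hg : g.toRationalMap = E.duplication) : g.hom ≫ E.π = g.domain.ι ≫ E.π := by
  refine ext_of_isDominant (genericLift g.dense_domain.nonempty) ?_
  rw [← Category.assoc, ← Category.assoc, genericLift_ι, E.genericLift_duplication hg]
  exact (2 • E.tautologicalPoint).2.trans (genericMap_comp E.π).symm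

end EllipticSurface

theorem exists_algebra_functionField {R : Type} [CommRing R] {X : Scheme.{0}} [IsIntegral X]
    (s : X ⟶ Spec (.of R)) :
    ∃ _ : Algebra R (FunctionField X), genericMap X ≫ s = specHom (algebraMap R _) := by
  obtain ⟨c, hc⟩ := Spec.map_surjective (genericMap X ≫ s)
  exact ⟨c.hom.toAlgebra, hc.symm⟩

/-! ### From the square of rational maps to points over the function field of `X` -/

namespace EllipticSurface

section
variable {Y : Scheme.{0}} [Y.Over (Spec (.of ℂ))] [IsIntegral Y] (E : EllipticSurface Y)

open Classical in
theorem pointEquiv_map {M L : Type} [Field M] [Field L] [Algebra (FunctionField Y) M]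
    [Algebra (FunctionField Y) L] (g : M →ₐ[FunctionField Y] L)
    (P : (E.weierstrass.map (algebraMap (FunctionField Y) M)).toAffine.Point) :
    (E.pointEquiv (algebraMap _ L) (pointMap g P)).1 =
      specHom (g : M →+* L) ≫ (E.pointEquiv (algebraMap _ M) P).1 := by
  rw [pointEquiv_coe, pointEquiv_coe, pointHom_map, Category.assoc]
  rfl

open Classical in
theorem two_nsmul_eq_of_duplication_apply [Y.IsSeparated] {g : E.carrier.PartialMap E.carrier}
    (hg : g.toRationalMap = E.duplication) {L : Type} [Field L] [Algebra (FunctionField Y) L]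
    (P S : (E.weierstrass.map (algebraMap (FunctionField Y) L)).toAffine.Point)
    (hP : P ≠ 0) (hP2 : 2 • P ≠ 0) (p : Spec (.of L) ⟶ g.domain)
    (hp : p ≫ g.domain.ι = (E.pointEquiv _ P).1) (hS : p ≫ g.hom = (E.pointEquiv _ S).1) :
    2 • P = S := by
  match P with
  | .zero => exact (hP rfl).elim
  | .some x y h =>
    apply (E.pointEquiv _).injective
    apply Subtype.ext
    rw [← hS]
    -- If `2y + a₁x + a₃` vanished, the point would equal its negative, against `hP2`.
    refine (E.duplication_apply hg _ h (fun hD ↦ hP2 ?_) p hp).symm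
    rw [two_nsmul]
    apply WeierstrassCurve.Affine.Point.add_self_of_Y_eq
    rw [evalHom_coordD] at hD
    rw [WeierstrassCurve.Affine.negY]
    linear_combination hD

end

variable {Y : Scheme.{0}} [Y.Over (Spec (.of ℂ))] [IsSmoothProjectiveCurve Y]
  (E : EllipticSurface Y)

theorem sectionToPoint_nsmul (n : ℕ) (s : E.Section) :
    E.sectionToPoint (n • s) = n • E.sectionToPoint s :=
  map_nsmul E.sectionEquiv.addEquiv n s

theorem eq_top_of_generic_factor {X : Scheme.{0}} [X.Over (Spec (.of ℂ))] [IsSmoothProjectiveCurve X]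
    (φ : X ⟶ Y) [φ.IsOver (Spec (.of ℂ))] [IsDominant φ] {Z : Scheme.{0}} {τ : X ⟶ Z}
    (hτ : GenericallyInjective τ) [Algebra (FunctionField Y) (FunctionField X)]
    (hφ : algebraMap (FunctionField Y) (FunctionField X) = functionFieldMap φ)
    [FiniteDimensional (FunctionField Y) (FunctionField X)]
    (M : IntermediateField (FunctionField Y) (FunctionField X)) (q : Spec (.of M) ⟶ Z)
    (hq : genericMap X ≫ τ = specHom (algebraMap M (FunctionField X)) ≫ q) : M = ⊤ := by
  obtain ⟨_, hX⟩ := exists_algebra_functionField (X ↘ Spec (.of ℂ))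
  obtain ⟨_, hY⟩ := exists_algebra_functionField (Y ↘ Spec (.of ℂ))
  -- `φ` is a morphism over `ℂ`, so the constants of `K(Y)` and `K(X)` are compatible and `M` is
  -- also an intermediate field over `ℂ`.
  have : IsScalarTower ℂ (FunctionField Y) (FunctionField X) := by
    refine .of_algebraMap_eq' ?_
    refine congrArg CommRingCat.Hom.hom (Spec.map_injective (?_ : specHom _ = specHom _))
    change specHom (algebraMap _ _) =
      specHom ((algebraMap (FunctionField Y) _).comp (algebraMap _ (FunctionField Y)))
    rw [← hX, ← comp_over φ (Spec (.of ℂ)), ← Category.assoc, genericMap_comp, Category.assoc, hY,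
      ← hφ]
    exact (Spec.map_comp _ _).symm
  have : FiniteDimensional (M.restrictScalars ℂ) (FunctionField X) :=
    inferInstanceAs (FiniteDimensional M (FunctionField X))
  have : SmoothOfRelativeDimension 1 (X ↘ Spec (.of ℂ)) := inferInstance
  have : Smooth (X ↘ Spec (.of ℂ)) := SmoothOfRelativeDimension.smooth 1 _
  have h := hτ.eq_top (X ↘ Spec (.of ℂ)) hX (M.restrictScalars ℂ) q hq
  exact (IntermediateField.restrictScalars_eq_top_iff).mp h

theorem two_nsmul_ne_of_duplicationSquare {X : Scheme.{0}} [X.Over (Spec (.of ℂ))]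
    [IsSmoothProjectiveCurve X] (φ : X ⟶ Y) [φ.IsOver (Spec (.of ℂ))] [IsDominant φ]
    (hφ : degree φ = 4) (σ : E.Section) (τ : X ⟶ E.carrier) (hτ : GenericallyInjective τ)
    (h : E.DuplicationSquare φ τ σ) (σ' : E.Section) :
    2 • σ' ≠ σ := by
  classical
  rintro rfl
  let _ : Algebra (FunctionField Y) (FunctionField X) := (functionFieldMap φ).toAlgebra
  have hdeg : Module.finrank (FunctionField Y) (FunctionField X) = 4 := hφ
  -- A nonzero `finrank` excludes the default value 0 of infinite extensions.
  have : FiniteDimensional (FunctionField Y) (FunctionField X) := .of_finrank_pos (by omega)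
  have : CharZero (FunctionField Y) := by
    obtain ⟨_, -⟩ := exists_algebra_functionField (Y ↘ Spec (.of ℂ))
    exact charZero_of_injective_algebraMap (algebraMap ℂ (FunctionField Y)).injective
  obtain ⟨g, hg, U, hU, hne, hsq⟩ := h
  let p : Spec (.of (FunctionField X)) ⟶ g.domain := genericLift hne ≫ τ.resLE g.domain U hU
  have hpι : p ≫ g.domain.ι = genericMap X ≫ τ := by
    rw [Category.assoc, Scheme.Hom.resLE_comp_ι, ← Category.assoc, genericLift_ι]
  have hpg : p ≫ g.hom = genericMap X ≫ φ ≫ (2 • σ').1 := by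
    rw [Category.assoc, hsq, ← Category.assoc, genericLift_ι]
  have hπ : (genericMap X ≫ τ) ≫ E.π =
      specHom (algebraMap (FunctionField Y) (FunctionField X)) ≫ genericMap Y := by
    rw [← hpι, Category.assoc, ← E.duplication_hom_π hg, ← Category.assoc, hpg, Category.assoc,
      Category.assoc, (2 • σ').2, Category.comp_id]
    exact genericMap_comp φ
  obtain ⟨P, hP⟩ := (E.pointEquiv (algebraMap _ (FunctionField X))).surjective ⟨genericMap X ≫ τ, hπ⟩
  replace hP := congrArg Subtype.val hP
  have hM (M : IntermediateField (FunctionField Y) (FunctionField X))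
      (hM3 : Module.finrank (FunctionField Y) M ≤ 3)
      (Q : (E.weierstrass.map (algebraMap (FunctionField Y) M)).toAffine.Point) :
      pointMap M.val Q ≠ P := by
    rintro rfl
    have := eq_top_of_generic_factor φ hτ rfl M _ (hP.symm.trans (E.pointEquiv_map M.val Q))
    rw [this, IntermediateField.finrank_top', hdeg] at hM3
    omega
  -- `P` is not the sum of a point killed by 2 and a `K(Y)`-rational point: such a sum is defined
  -- over the field of `T`, of degree at most 3.
  have htor (T : (E.weierstrass.map (algebraMap (FunctionField Y) (FunctionField X))).toAffine.Point)
      (hT : 2 • T = 0)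
      (S : (E.weierstrass.map (algebraMap (FunctionField Y) (FunctionField Y))).toAffine.Point) :
      T + pointMap (Algebra.ofId (FunctionField Y) (FunctionField X)) S ≠ P := by
    obtain ⟨M, hM3, T', rfl⟩ := exists_intermediateField_of_two_nsmul_eq_zero E.weierstrass T hT
    convert hM M hM3 (T' + pointMap (Algebra.ofId _ _) S) using 1
    rw [pointMap_add, pointMap_pointMap]
    rfl
  obtain ⟨S, hS⟩ := (E.pointEquiv (algebraMap (FunctionField Y) (FunctionField Y))).surjective
    (E.sectionToPoint σ')
  have h2S : E.pointEquiv (algebraMap (FunctionField Y) (FunctionField Y)) (2 • S) =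
      E.sectionToPoint (2 • σ') := by
    rw [pointEquiv_nsmul, hS, sectionToPoint_nsmul]
  -- The choices `T = 0` and `T = P`, both with `S = 0`, give the nonvanishing needed to evaluate
  -- `2_E` at `P`.
  have hP0 : P ≠ 0 := fun e ↦ htor 0 (smul_zero 2) 0 (by rw [pointMap_zero, e, zero_add])
  have hP2 : 2 • P ≠ 0 := fun e ↦ htor P e 0 (by rw [pointMap_zero, add_zero])
  have key := E.two_nsmul_eq_of_duplication_apply hg P
    (pointMap (Algebra.ofId _ _) (2 • S)) hP0 hP2 p (hpι.trans hP.symm) (by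
      rw [hpg, ← Category.assoc, genericMap_comp, Category.assoc]
      refine Eq.trans ?_ (E.pointEquiv_map (Algebra.ofId (FunctionField Y) (FunctionField X)) _).symm
      exact congrArg (fun q ↦ specHom (algebraMap _ (FunctionField X)) ≫ q)
        (congrArg Subtype.val h2S).symm)
  -- Here `S` is the generic point of `σ'`, and `key` says that the difference is killed by 2.
  refine htor (P - pointMap (Algebra.ofId _ _) S) ?_ S
    (sub_add_cancel _ _)
  rw [nsmul_sub, key, pointMap_nsmul, sub_self]

end EllipticSurface
end EllipticDuplication

theorem mainTheorem9 {X Y : Scheme.{0}} [X.Over (Spec (.of ℂ))] [Y.Over (Spec (.of ℂ))]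
    [EllipticDuplication.IsSmoothProjectiveCurve X] [EllipticDuplication.IsSmoothProjectiveCurve Y]
    (φ : X ⟶ Y) [φ.IsOver (Spec (.of ℂ))] [IsDominant φ]
    (hφ : EllipticDuplication.degree φ = 4)
    (E : EllipticDuplication.EllipticSurface Y) (σ : E.Section) (τ : X ⟶ E.carrier)
    (hτ : EllipticDuplication.GenericallyInjective τ) (h : E.DuplicationSquare φ τ σ) :
    (¬ ∃ σ' : E.Section, 2 • σ' = σ) ∧ σ ≠ E.zeroSection ∧
      ∃ s : E.Section, s ≠ E.zeroSection := by
  have key (σ' : E.Section) : 2 • σ' ≠ σ := E.two_nsmul_ne_of_duplicationSquare φ hφ σ τ hτ h σ'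
  have h0 : σ ≠ E.zeroSection := by
    rw [E.zeroSection_eq_zero]
    exact fun e ↦ key 0 (by rw [e, smul_zero])
  exact ⟨fun ⟨σ', e⟩ ↦ key σ' e, h0, σ, h0⟩
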